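/- Let $\varrho = \frac12\delta_{-1}+\frac12\delta_{1}$ and $0<\beta<1$. For each integer $n\ge 1$ let $P_n$ be the classical Curie–Weiss measure at inverse temperature $\beta$, i.e. the probability measure on $\mathbb{R}^n$ (concentrated on $\{-1,+1\}^n$) $$dP_n(x)=\frac{1}{Z_n(\beta)}\exp\Big(\frac{\beta}{2n}\,S_n(x)^2\Big)\,d\varrho^{\otimes n}(x),\qquad S_n(x)=\sum_{i=1}^n x_i,\qquad Z_n(\beta)=\int \exp\Big(\frac{\beta}{2n}S_n^2\Big)\,d\varrho^{\otimes n}.$$ Then there is a constant $C$, depending only on $\beta$, such that for every $n\ge 1$ $$\sup_{z\in\mathbb{R}}\Big|P_n\Big(\frac{S_n}{\sqrt n}\le z\Big)-\Phi_\beta(z)\Big|\le C\,n^{-1/2},$$ where $\Phi_\beta$ is the distribution function of the normal distribution with expectation $0$ and variance $(1-\beta)^{-1}$. -/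

import Mathlib

open MeasureTheory ProbabilityTheory
open scoped ENNReal

noncomputable section

/-- The law `(1/2) δ₋₁ + (1/2) δ₁` of a single classical spin. -/
def classicalSpin : Measure ℝ :=
  (2⁻¹ : ℝ≥0∞) • Measure.dirac (-1) + (2⁻¹ : ℝ≥0∞) • Measure.dirac 1

/-- The total magnetization `S_n(x) = x_1 + ⋯ + x_n` of a spin configuration. -/
def magnetization (n : ℕ) (x : Fin n → ℝ) : ℝ := ∑ i, x i

/-- The Curie-Weiss measure with single-spin law `ϱ` on `n` sites at inverse temperature `β`:
the probability measure `Z⁻¹ exp ((β / (2 n)) S_n(x)²) dϱ^{⊗ n}(x)`, where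
`Z = ∫ exp ((β / (2 n)) S_n²) dϱ^{⊗ n}` is the partition function. -/
def curieWeiss (ϱ : Measure ℝ) (n : ℕ) (β : ℝ) : Measure (Fin n → ℝ) :=
  (Measure.pi fun _ : Fin n => ϱ).tilted fun x => β / (2 * n) * magnetization n x ^ 2

instance classicalSpin_isProbabilityMeasure : IsProbabilityMeasure classicalSpin :=
  ⟨by simp [classicalSpin, ENNReal.inv_two_add_inv_two]⟩

/-- For classical spins the partition function is finite, so that the Curie-Weiss measure is a
probability measure. -/
instance curieWeiss_isProbabilityMeasure (n : ℕ) (β : ℝ) :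
    IsProbabilityMeasure (curieWeiss classicalSpin n β) := by
  have hspin : ∀ᵐ s ∂classicalSpin, |s| ≤ 1 := by
    have hm : MeasurableSet {s : ℝ | |s| ≤ 1}ᶜ :=
      (measurableSet_le measurable_norm measurable_const).compl
    change classicalSpin {s : ℝ | |s| ≤ 1}ᶜ = 0
    simp [classicalSpin, Measure.dirac_apply' _ hm]
  have hpi : ∀ᵐ x ∂(Measure.pi fun _ : Fin n => classicalSpin), ∀ i, |x i| ≤ 1 :=
    ae_all_iff.2 fun i =>
      (measurePreserving_eval (fun _ : Fin n => classicalSpin) i).quasiMeasurePreserving.ae hspin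
  refine isProbabilityMeasure_tilted ?_
  refine Integrable.of_bound (C := Real.exp (|β / (2 * n)| * (n : ℝ) ^ 2))
    (by unfold magnetization; fun_prop) ?_
  filter_upwards [hpi] with x hx
  have hS : |magnetization n x| ≤ n := by
    refine (Finset.abs_sum_le_sum_abs _ _).trans ((Finset.sum_le_sum fun i _ => hx i).trans ?_)
    simp
  rw [Real.norm_eq_abs, Real.abs_exp, Real.exp_le_exp]
  refine (le_abs_self _).trans ?_
  rw [abs_mul, abs_pow]
  gcongr

end

/-! Stein's method, with `a = 1 - β`, `δ = n^(-1/2)` and `W = δ * S_n`. Let `f` be the bounded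
solution of `f' - a w f = c (1_{w < z} - Φ z)`. Given the other spins, spin `i` has mean `tanh (β δ
V)`, where `V = W - δ σ_i`. Summing over `i` gives an exact integration by parts, `E[W f(W)] = δ ∑
E[siteTerm]` (`gibbsMean_spin_mul`). Each site term is `δ (β W f(W) + f'(W))` up to `O(δ² (1 +
W²))`, so `E[f'(W) - a W f(W)]` nearly vanishes and the Stein equation returns `P(W < z) - Φ z =
O(δ)`. The second moment of `W` is bounded by the same identity applied to `f(x) = x`.

The jump of `f'` at `z` needs no concentration inequality: the increment of `f` only involves points
within `2δ` of `W`, so the indicator is sandwiched between two shifted ones, and the Lipschitz bound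
on `Φ` absorbs the shift. -/

open Filter Topology Set

/-! ### Gaussian distribution functions -/

/-- `Φ` is the distribution function of a centred Gaussian of variance `a⁻¹`, whose density at
the origin is `c`. -/
structure IsGaussianCDF (a c : ℝ) (Φ : ℝ → ℝ) : Prop where
  a_pos : 0 < a
  c_pos : 0 < c
  hasDerivAt : ∀ w, HasDerivAt Φ (c * Real.exp (-(a * w ^ 2 / 2))) w
  tendsto_atTop : Tendsto Φ atTop (𝓝 1)
  tendsto_atBot : Tendsto Φ atBot (𝓝 0)
  nonneg : ∀ w, 0 ≤ Φ w
  le_one : ∀ w, Φ w ≤ 1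
  mono : Monotone Φ

theorem isGaussianCDF_cdf_gaussianReal {a : ℝ} (ha : 0 < a) :
    ∃ c, IsGaussianCDF a c (cdf (gaussianReal 0 a⁻¹.toNNReal)) := by
  have hv : (a⁻¹.toNNReal : ℝ) = a⁻¹ := Real.coe_toNNReal _ (inv_pos.2 ha).le
  have hv0 : a⁻¹.toNNReal ≠ 0 := (Real.toNNReal_pos.2 (inv_pos.2 ha)).ne'
  have hc : 0 < (√(2 * Real.pi * a⁻¹))⁻¹ := by positivity
  refine ⟨(√(2 * Real.pi * a⁻¹))⁻¹, ha, hc, fun w => ?_, tendsto_cdf_atTop _,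
    tendsto_cdf_atBot _, cdf_nonneg _, cdf_le_one _, monotone_cdf _⟩
  have hpdf : gaussianPDFReal 0 a⁻¹.toNNReal
      = fun x => (√(2 * Real.pi * a⁻¹))⁻¹ * Real.exp (-(a * x ^ 2 / 2)) := by
    ext x
    rw [gaussianPDFReal, hv]
    congr 2
    field_simp
    ring
  have hint := integrable_gaussianPDFReal 0 a⁻¹.toNNReal
  have hcdf : ∀ x, cdf (gaussianReal 0 a⁻¹.toNNReal) x
      = (∫ u in Iic (0 : ℝ), gaussianPDFReal 0 a⁻¹.toNNReal u)
        + ∫ u in (0 : ℝ)..x, gaussianPDFReal 0 a⁻¹.toNNReal u := by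
    intro x
    rw [← intervalIntegral.integral_Iic_sub_Iic hint.integrableOn hint.integrableOn, cdf_eq_real,
      Measure.real, gaussianReal_apply_eq_integral _ hv0, ENNReal.toReal_ofReal]
    · ring
    · exact integral_nonneg fun u => gaussianPDFReal_nonneg _ _ _
  rw [show (cdf (gaussianReal 0 a⁻¹.toNNReal) : ℝ → ℝ) = _ from funext hcdf]
  have hcont : Continuous (gaussianPDFReal 0 a⁻¹.toNNReal) := by
    rw [hpdf]; fun_prop
  have := (hcont.integral_hasStrictDerivAt 0 w).hasDerivAt.const_add
    (∫ u in Iic (0 : ℝ), gaussianPDFReal 0 a⁻¹.toNNReal u)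
  rwa [congrFun hpdf w] at this

namespace IsGaussianCDF

variable {a c : ℝ} {Φ : ℝ → ℝ}

/-- This symmetry turns upper tail bounds into lower tail bounds. -/
theorem reflect (h : IsGaussianCDF a c Φ) : IsGaussianCDF a c fun x => 1 - Φ (-x) where
  a_pos := h.a_pos
  c_pos := h.c_pos
  hasDerivAt w := by
    have := ((h.hasDerivAt (-w)).comp w (hasDerivAt_neg w)).const_sub 1
    simpa using this
  tendsto_atTop := by simpa using (h.tendsto_atBot.comp tendsto_neg_atTop_atBot).const_sub 1
  tendsto_atBot := by simpa using (h.tendsto_atTop.comp tendsto_neg_atBot_atTop).const_sub 1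
  nonneg w := sub_nonneg.2 (h.le_one _)
  le_one w := sub_le_self _ (h.nonneg _)
  mono x y hxy := sub_le_sub_left (h.mono (neg_le_neg hxy)) _

theorem continuous (h : IsGaussianCDF a c Φ) : Continuous Φ :=
  continuous_iff_continuousAt.2 fun x => (h.hasDerivAt x).continuousAt

theorem sub_le (h : IsGaussianCDF a c Φ) {x y : ℝ} (hxy : x ≤ y) :
    Φ y - Φ x ≤ c * (y - x) := by
  refine Convex.image_sub_le_mul_sub_of_deriv_le convex_univ h.continuous.continuousOn
    (fun x _ => (h.hasDerivAt x).differentiableAt.differentiableWithinAt) ?_ x trivial y trivial hxy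
  intro x _
  rw [(h.hasDerivAt x).deriv]
  refine mul_le_of_le_one_right h.c_pos.le (Real.exp_le_one_iff.2 ?_)
  have := h.a_pos
  have : 0 ≤ a * x ^ 2 / 2 := by positivity
  linarith

/-- The Gaussian upper tail bound. -/
theorem mul_one_sub_le (h : IsGaussianCDF a c Φ) {w : ℝ} (hw : 0 ≤ w) :
    w * (1 - Φ w) ≤ c / a * Real.exp (-(a * w ^ 2 / 2)) := by
  have ha := h.a_pos
  have hc := h.c_pos
  rcases hw.eq_or_lt with rfl | hw
  · simp; positivity
  -- The point `w` is frozen in the first factor, so `k'` has the sign of `x - w`: `k` increases on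
  -- `[w, ∞)` to its limit `0`, hence `k w ≤ 0`.
  set k : ℝ → ℝ := fun x => w * (1 - Φ x) - c / a * Real.exp (-(a * x ^ 2 / 2)) with hk
  have hder : ∀ x, HasDerivAt k (c * (x - w) * Real.exp (-(a * x ^ 2 / 2))) x := by
    intro x
    have h1 := ((h.hasDerivAt x).const_sub 1).const_mul w
    have h2 : HasDerivAt (fun x : ℝ => -(a * x ^ 2 / 2)) (-(a * x)) x := by
      refine (((hasDerivAt_pow 2 x).const_mul a).div_const 2).neg.congr_deriv ?_
      simp; ring
    have h3 := h1.sub (h2.exp.const_mul (c / a))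
    refine h3.congr_deriv ?_
    field_simp
    ring
  have hmono : MonotoneOn k (Ici w) := by
    refine monotoneOn_of_hasDerivWithinAt_nonneg (convex_Ici w)
      (fun x _ => (hder x).continuousAt.continuousWithinAt)
      (fun x _ => (hder x).hasDerivWithinAt) fun x hx => ?_
    rw [interior_Ici] at hx
    have : 0 ≤ x - w := sub_nonneg.2 (le_of_lt hx)
    positivity
  have hlim : Tendsto k atTop (𝓝 0) := by
    have h1 : Tendsto (fun x : ℝ => Real.exp (-(a * x ^ 2 / 2))) atTop (𝓝 0) := by
      refine Real.tendsto_exp_neg_atTop_nhds_zero.comp ?_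
      exact ((tendsto_pow_atTop two_ne_zero).const_mul_atTop ha).atTop_div_const two_pos
    simpa using ((h.tendsto_atTop.const_sub 1).const_mul w).sub (h1.const_mul (c / a))
  have : k w ≤ 0 := ge_of_tendsto hlim
    ((eventually_ge_atTop w).mono fun x hx => hmono self_mem_Ici hx hx)
  simpa [hk] using this

end IsGaussianCDF

/-! ### The Stein equation -/

/-- The bounded solution of the Stein equation `f' - a w f = c (1_{w ≤ z} - Φ z)`. -/
noncomputable def steinSolution (a : ℝ) (Φ : ℝ → ℝ) (z w : ℝ) : ℝ :=
  Real.exp (a * w ^ 2 / 2) * (Φ (min w z) - Φ w * Φ z)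

/-- The right derivative of `steinSolution`. -/
noncomputable def steinSolutionDeriv (a c : ℝ) (Φ : ℝ → ℝ) (z w : ℝ) : ℝ :=
  a * (w * steinSolution a Φ z w) + c * ((if w < z then 1 else 0) - Φ z)

namespace IsGaussianCDF

variable {a c : ℝ} {Φ : ℝ → ℝ}

theorem steinSolution_nonneg (h : IsGaussianCDF a c Φ) (z w : ℝ)
    : 0 ≤ steinSolution a Φ z w := by
  refine mul_nonneg (Real.exp_pos _).le ?_
  have := h.nonneg w; have := h.nonneg z; have := h.le_one w; have := h.le_one z
  rcases le_total w z with hwz | hwz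
  · rw [min_eq_left hwz]; nlinarith
  · rw [min_eq_right hwz]; nlinarith

theorem steinSolution_le_left (h : IsGaussianCDF a c Φ) (z w : ℝ)
    : steinSolution a Φ z w ≤ Real.exp (a * w ^ 2 / 2) * Φ w := by
  refine mul_le_mul_of_nonneg_left ?_ (Real.exp_pos _).le
  have := h.mono (min_le_left w z)
  have := mul_nonneg (h.nonneg w) (h.nonneg z)
  linarith

theorem steinSolution_le_right (h : IsGaussianCDF a c Φ) (z w : ℝ)
    :
    steinSolution a Φ z w ≤ Real.exp (a * w ^ 2 / 2) * (1 - Φ w) := by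
  refine mul_le_mul_of_nonneg_left ?_ (Real.exp_pos _).le
  have := h.nonneg w; have := h.nonneg z; have := h.le_one w; have := h.le_one z
  rcases le_total w z with hwz | hwz
  · rw [min_eq_left hwz]; nlinarith [h.mono hwz]
  · rw [min_eq_right hwz]; nlinarith [h.mono hwz]

/-- The factor `exp (a w² / 2)` cancels the Gaussian tail bound, taken on the side of the origin
where `w` lies. -/
theorem abs_mul_steinSolution_le (h : IsGaussianCDF a c Φ) (z w : ℝ)
    : |w| * steinSolution a Φ z w ≤ c / a := by
  have he := Real.exp_pos (a * w ^ 2 / 2)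
  have key : ∀ t, |w| * t ≤ c / a * Real.exp (-(a * w ^ 2 / 2)) →
      |w| * (Real.exp (a * w ^ 2 / 2) * t) ≤ c / a := by
    intro t ht
    rw [Real.exp_neg, ← div_eq_mul_inv, le_div_iff₀ he] at ht
    linarith
  rcases le_total 0 w with hw | hw
  · refine (mul_le_mul_of_nonneg_left (h.steinSolution_le_right z w) (abs_nonneg w)).trans
      (key _ ?_)
    rw [abs_of_nonneg hw]
    exact h.mul_one_sub_le hw
  · refine (mul_le_mul_of_nonneg_left (h.steinSolution_le_left z w) (abs_nonneg w)).trans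
      (key _ ?_)
    rw [abs_of_nonpos hw]
    simpa using h.reflect.mul_one_sub_le (neg_nonneg.2 hw)

theorem steinSolution_le (h : IsGaussianCDF a c Φ) (z w : ℝ)
    : steinSolution a Φ z w ≤ Real.exp (a / 2) + c / a := by
  have ha := h.a_pos
  have hc := h.c_pos
  rcases le_total |w| 1 with hw | hw
  · have h1 := h.steinSolution_le_left z w
    have h2 : Real.exp (a * w ^ 2 / 2) ≤ Real.exp (a / 2) := by
      rw [Real.exp_le_exp]
      have : w ^ 2 ≤ 1 := (sq_le_one_iff_abs_le_one w).2 hw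
      nlinarith
    have := h.le_one w
    have := Real.exp_pos (a * w ^ 2 / 2)
    have : 0 < c / a := by positivity
    nlinarith
  · have h1 := h.abs_mul_steinSolution_le z w
    have := Real.exp_pos (a / 2)
    nlinarith [h.steinSolution_nonneg z w]

theorem continuous_steinSolution (h : IsGaussianCDF a c Φ) (z : ℝ)
    : Continuous (steinSolution a Φ z) := by
  have := h.continuous
  unfold steinSolution
  fun_prop

/-- At `w = z` the one-sided derivatives differ; the right one goes with the strict indicator `w <
z`. Right derivatives and continuity suffice for the mean value inequalities below. -/
theorem hasDerivWithinAt_steinSolution (h : IsGaussianCDF a c Φ) (z w : ℝ)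
    :
    HasDerivWithinAt (steinSolution a Φ z) (steinSolutionDeriv a c Φ z w) (Ici w) w := by
  have he : HasDerivAt (fun x : ℝ => Real.exp (a * x ^ 2 / 2))
      (Real.exp (a * w ^ 2 / 2) * (a * w)) w := by
    refine HasDerivAt.exp ?_
    refine (((hasDerivAt_pow 2 w).const_mul a).div_const 2).congr_deriv ?_
    simp; ring
  have hexp : Real.exp (a * w ^ 2 / 2) * Real.exp (-(a * w ^ 2 / 2)) = 1 := by
    rw [← Real.exp_add]; simp
  unfold steinSolutionDeriv steinSolution
  split_ifs with hwz
  · have h1 := he.mul ((h.hasDerivAt w).sub ((h.hasDerivAt w).mul_const (Φ z)))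
    refine HasDerivAt.hasDerivWithinAt ?_
    refine (h1.congr_of_eventuallyEq ?_).congr_deriv ?_
    · filter_upwards [Iio_mem_nhds hwz] with x hx
      simp [min_eq_left (mem_Iio.1 hx).le]
    · rw [min_eq_left hwz.le, Pi.sub_apply]
      linear_combination (c * (1 - Φ z)) * hexp
  · have h1 := he.mul (((h.hasDerivAt w).mul_const (Φ z)).const_sub (Φ z))
    rw [not_lt] at hwz
    refine (h1.hasDerivWithinAt.congr ?_ ?_).congr_deriv ?_
    · intro x hx
      simp [min_eq_right (hwz.trans hx)]
    · simp [min_eq_right hwz]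
    · rw [min_eq_right hwz]
      linear_combination (-c * Φ z) * hexp

theorem abs_steinSolutionDeriv_le (h : IsGaussianCDF a c Φ) (z w : ℝ)
    : |steinSolutionDeriv a c Φ z w| ≤ 2 * c := by
  have ha := h.a_pos
  have hc := h.c_pos
  have h1 : |a * (w * steinSolution a Φ z w)| ≤ c := by
    rw [abs_mul, abs_mul, abs_of_pos ha, abs_of_nonneg (h.steinSolution_nonneg z w)]
    have := h.abs_mul_steinSolution_le z w
    rw [le_div_iff₀ ha] at this
    linarith
  have h2 : |(if w < z then 1 else 0) - Φ z| ≤ 1 := by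
    have := h.nonneg z; have := h.le_one z
    split_ifs <;> rw [abs_le] <;> constructor <;> linarith
  have h3 : |c * ((if w < z then 1 else 0) - Φ z)| ≤ c := by
    rw [abs_mul, abs_of_pos hc]
    exact mul_le_of_le_one_right hc.le h2
  exact (abs_add_le _ _).trans (by linarith)

theorem le_steinSolution_sub (h : IsGaussianCDF a c Φ) (z : ℝ)
    {A u v : ℝ} (huv : u ≤ v)
    (hA : ∀ x ∈ Ico u v, A ≤ steinSolutionDeriv a c Φ z x) :
    A * (v - u) ≤ steinSolution a Φ z v - steinSolution a Φ z u := by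
  have := image_le_of_deriv_right_le_deriv_boundary (a := u) (b := v)
    (f := fun x => steinSolution a Φ z u + A * (x - u)) (f' := fun _ => A)
    (B := steinSolution a Φ z) (B' := steinSolutionDeriv a c Φ z) (by fun_prop)
    (fun x _ => by
      have := (((hasDerivAt_id x).sub_const u).const_mul A).const_add (steinSolution a Φ z u)
      simpa using this.hasDerivWithinAt)
    (by simp) (h.continuous_steinSolution z).continuousOn
    (fun x _ => h.hasDerivWithinAt_steinSolution z x) hA (right_mem_Icc.2 huv)
  linarith

theorem steinSolution_sub_le (h : IsGaussianCDF a c Φ) (z : ℝ)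
    {A u v : ℝ} (huv : u ≤ v)
    (hA : ∀ x ∈ Ico u v, steinSolutionDeriv a c Φ z x ≤ A) :
    steinSolution a Φ z v - steinSolution a Φ z u ≤ A * (v - u) := by
  have := image_le_of_deriv_right_le_deriv_boundary (a := u) (b := v)
    (B := fun x => steinSolution a Φ z u + A * (x - u)) (B' := fun _ => A)
    (f := steinSolution a Φ z) (f' := steinSolutionDeriv a c Φ z)
    (h.continuous_steinSolution z).continuousOn
    (fun x _ => h.hasDerivWithinAt_steinSolution z x) (by simp) (by fun_prop)
    (fun x _ => by
      have := (((hasDerivAt_id x).sub_const u).const_mul A).const_add (steinSolution a Φ z u)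
      simpa using this.hasDerivWithinAt)
    hA (right_mem_Icc.2 huv)
  linarith

theorem abs_steinSolution_sub_le (h : IsGaussianCDF a c Φ) (z : ℝ)
    (u v : ℝ) :
    |steinSolution a Φ z u - steinSolution a Φ z v| ≤ 2 * c * |u - v| := by
  have key : ∀ {u v : ℝ}, u ≤ v →
      |steinSolution a Φ z u - steinSolution a Φ z v| ≤ 2 * c * |u - v| := by
    intro u v huv
    have h1 := h.steinSolution_sub_le z huv
      fun x _ => (abs_le.1 (h.abs_steinSolutionDeriv_le z x)).2
    have h2 := h.le_steinSolution_sub z huv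
      fun x _ => (abs_le.1 (h.abs_steinSolutionDeriv_le z x)).1
    rw [abs_sub_comm, abs_sub_comm u, abs_of_nonneg (sub_nonneg.2 huv), abs_le]
    constructor <;> linarith
  rcases le_total u v with huv | huv
  · exact key huv
  · rw [abs_sub_comm, abs_sub_comm u]; exact key huv

end IsGaussianCDF

/-! ### Elementary bounds on `tanh` -/

namespace Real

theorem tanh_nonneg_of_nonneg {u : ℝ} (hu : 0 ≤ u) : 0 ≤ tanh u := by
  rw [tanh_eq_sinh_div_cosh]
  exact div_nonneg (sinh_nonneg_iff.2 hu) (cosh_pos u).le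

theorem tanh_le_self_of_nonneg {u : ℝ} (hu : 0 ≤ u) : tanh u ≤ u := by
  have hmono : MonotoneOn (fun x => x * cosh x - sinh x) (Ici 0) := by
    have hder : ∀ x, HasDerivAt (fun x => x * cosh x - sinh x) (x * sinh x) x := by
      intro x
      refine (((hasDerivAt_id x).mul (hasDerivAt_cosh x)).sub (hasDerivAt_sinh x)).congr_deriv ?_
      simp
    refine monotoneOn_of_hasDerivWithinAt_nonneg (convex_Ici 0)
      (fun x _ => (hder x).continuousAt.continuousWithinAt)
      (fun x _ => (hder x).hasDerivWithinAt) fun x hx => ?_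
    rw [interior_Ici] at hx
    exact mul_nonneg (le_of_lt hx) (sinh_nonneg_iff.2 (le_of_lt hx))
  have := hmono self_mem_Ici hu hu
  rw [tanh_eq_sinh_div_cosh, div_le_iff₀ (cosh_pos u)]
  simpa using this

theorem sub_sq_le_tanh_of_nonneg {u : ℝ} (hu : 0 ≤ u) : u - u ^ 2 ≤ tanh u := by
  -- After clearing denominators this is `1 + 2u ≤ exp (2u)`.
  have h1 : u / (1 + u) ≤ tanh u := by
    rw [tanh_eq_sinh_div_cosh, div_le_div_iff₀ (by linarith) (cosh_pos u), sinh_eq, cosh_eq]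
    have h2 := add_one_le_exp (2 * u)
    have h3 : exp u = exp (2 * u) * exp (-u) := by rw [← exp_add]; ring_nf
    nlinarith [exp_pos (-u)]
  refine le_trans ?_ h1
  rw [le_div_iff₀ (by linarith)]
  nlinarith [pow_nonneg hu 3]

theorem abs_tanh_le_abs (u : ℝ) : |tanh u| ≤ |u| := by
  rcases le_total 0 u with hu | hu
  · rw [abs_of_nonneg hu, abs_of_nonneg (tanh_nonneg_of_nonneg hu)]
    exact tanh_le_self_of_nonneg hu
  · rw [← abs_neg, ← tanh_neg, ← abs_neg u, abs_of_nonneg (neg_nonneg.2 hu),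
      abs_of_nonneg (tanh_nonneg_of_nonneg (neg_nonneg.2 hu))]
    exact tanh_le_self_of_nonneg (neg_nonneg.2 hu)

theorem abs_tanh_sub_self_le (u : ℝ) : |tanh u - u| ≤ u ^ 2 := by
  rcases le_total 0 u with hu | hu
  · have := tanh_le_self_of_nonneg hu
    have := sub_sq_le_tanh_of_nonneg hu
    rw [abs_le]; constructor <;> nlinarith
  · have h1 := tanh_le_self_of_nonneg (neg_nonneg.2 hu)
    have h2 := sub_sq_le_tanh_of_nonneg (neg_nonneg.2 hu)
    rw [tanh_neg] at h1 h2
    rw [abs_le]; constructor <;> nlinarith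

end Real

/-! ### The Curie-Weiss measure as a finite sum -/

/-- The spin configuration in `{-1, 1}ⁿ` encoded by a Boolean vector. -/
def spins {n : ℕ} (σ : Fin n → Bool) (i : Fin n) : ℝ := if σ i then 1 else -1

theorem pi_classicalSpin (n : ℕ) :
    (Measure.pi fun _ : Fin n => classicalSpin)
      = ∑ σ : Fin n → Bool, (2⁻¹ : ℝ≥0∞) ^ n • Measure.dirac (spins σ) := by
  refine Measure.pi_eq fun s hs => ?_
  have h1 : ∀ i, classicalSpin (s i)
      = ∑ b : Bool, 2⁻¹ * (s i).indicator 1 (if b then (1 : ℝ) else -1) := by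
    intro i
    simp [classicalSpin, Measure.dirac_apply' _ (hs i), add_comm]
  simp only [h1, Finset.prod_univ_sum, Fintype.piFinset_univ]
  simp only [Measure.coe_finsetSum, Finset.sum_apply, Measure.smul_apply, smul_eq_mul]
  refine Finset.sum_congr rfl fun σ _ => ?_
  rw [Measure.dirac_apply' _ (MeasurableSet.univ_pi hs), Finset.prod_mul_distrib]
  simp only [Finset.prod_const, Finset.card_univ, Fintype.card_fin]
  congr 1
  by_cases h : spins σ ∈ univ.pi s
  · rw [indicator_of_mem h, Finset.prod_eq_one]
    · rfl
    · exact fun i _ => indicator_of_mem (h i trivial) _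
  · rw [indicator_of_notMem h]
    simp only [Set.mem_pi, mem_univ, true_implies, not_forall] at h
    obtain ⟨i, hi⟩ := h
    exact (Finset.prod_eq_zero (Finset.mem_univ i) (indicator_of_notMem hi _)).symm

/-- The Gibbs weight of a configuration. -/
noncomputable def gibbsWeight (n : ℕ) (β : ℝ) (σ : Fin n → Bool) : ℝ :=
  Real.exp (β / (2 * n) * magnetization n (spins σ) ^ 2)

/-- The Gibbs expectation of an observable. -/
noncomputable def gibbsMean (n : ℕ) (β : ℝ) (g : (Fin n → Bool) → ℝ) : ℝ :=
  ∑ σ, gibbsWeight n β σ / (∑ τ, gibbsWeight n β τ) * g σ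

section gibbsMean

variable {n : ℕ} {β : ℝ} {g g' : (Fin n → Bool) → ℝ}

theorem gibbsWeight_pos (σ : Fin n → Bool) : 0 < gibbsWeight n β σ := Real.exp_pos _

theorem sum_gibbsWeight_pos : 0 < ∑ σ, gibbsWeight n β σ :=
  Finset.sum_pos (fun σ _ => gibbsWeight_pos σ) Finset.univ_nonempty

theorem gibbsMean_mono (h : ∀ σ, g σ ≤ g' σ) : gibbsMean n β g ≤ gibbsMean n β g' :=
  Finset.sum_le_sum fun σ _ => mul_le_mul_of_nonneg_left (h σ)
    (div_pos (gibbsWeight_pos σ) sum_gibbsWeight_pos).le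

theorem gibbsMean_add :
    gibbsMean n β (fun σ => g σ + g' σ) = gibbsMean n β g + gibbsMean n β g' := by
  simp [gibbsMean, mul_add, Finset.sum_add_distrib]

theorem gibbsMean_const_mul (r : ℝ) :
    gibbsMean n β (fun σ => r * g σ) = r * gibbsMean n β g := by
  rw [gibbsMean, gibbsMean, Finset.mul_sum]
  exact Finset.sum_congr rfl fun σ _ => by ring

theorem gibbsMean_sum {ι : Type*} (s : Finset ι) (G : ι → (Fin n → Bool) → ℝ) :
    gibbsMean n β (fun σ => ∑ i ∈ s, G i σ) = ∑ i ∈ s, gibbsMean n β (G i) := by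
  simp only [gibbsMean, Finset.mul_sum]
  exact Finset.sum_comm

theorem gibbsMean_const (r : ℝ) : gibbsMean n β (fun _ => r) = r := by
  rw [gibbsMean, ← Finset.sum_mul, ← Finset.sum_div, div_self sum_gibbsWeight_pos.ne', one_mul]

end gibbsMean

/-- The uniform factor `2⁻ⁿ` cancels between numerator and partition function. -/
theorem curieWeiss_real_eq_gibbsMean (n : ℕ) (β : ℝ) {A : Set (Fin n → ℝ)}
    (hA : MeasurableSet A) :
    (curieWeiss classicalSpin n β).real A
      = gibbsMean n β fun σ => A.indicator (fun _ => 1) (spins σ) := by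
  have hmeas : Measurable fun x : Fin n → ℝ =>
      Real.exp (β / (2 * n) * magnetization n x ^ 2) := by
    unfold magnetization; fun_prop
  have hpi : ∀ g : (Fin n → ℝ) → ℝ, Measurable g →
      ∫ x, g x ∂(Measure.pi fun _ : Fin n => classicalSpin)
        = ∑ σ : Fin n → Bool, (2⁻¹ : ℝ) ^ n * g (spins σ) := by
    intro g hg
    rw [pi_classicalSpin, integral_finsetSum_measure]
    · refine Finset.sum_congr rfl fun σ _ => ?_
      rw [integral_smul_measure, integral_dirac' _ _ hg.stronglyMeasurable]
      simp
    · intro σ _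
      refine Integrable.smul_measure ?_ (by simp)
      exact integrable_dirac' hg.stronglyMeasurable (by simp)
  have hind : Measurable (A.indicator fun _ => (1 : ℝ)) := measurable_const.indicator hA
  rw [← integral_indicator_one hA, curieWeiss, integral_tilted, hpi _ hmeas, hpi]
  · have hsum : ∑ σ : Fin n → Bool,
        (2⁻¹ : ℝ) ^ n * Real.exp (β / (2 * n) * magnetization n (spins σ) ^ 2)
        = (2⁻¹ : ℝ) ^ n * ∑ σ : Fin n → Bool, gibbsWeight n β σ :=
      (Finset.mul_sum _ _ _).symm
    rw [gibbsMean, hsum]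
    refine Finset.sum_congr rfl fun σ _ => ?_
    have h2 : ((2⁻¹ : ℝ) ^ n) ≠ 0 := by positivity
    have hZ := (sum_gibbsWeight_pos (n := n) (β := β)).ne'
    simp only [gibbsWeight] at hZ ⊢
    rw [smul_eq_mul]
    change _ = _ * (A.indicator 1 (spins σ) : ℝ)
    field_simp
  · exact (hmeas.div_const _).smul hind

/-! ### Gibbs integration by parts and the second moment -/

section flip

variable {n : ℕ} (σ : Fin n → Bool) (i : Fin n)

theorem spins_eq : spins σ i = 1 ∨ spins σ i = -1 := by
  unfold spins; split_ifs <;> simp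

theorem spins_update_self : spins (Function.update σ i (!σ i)) i = -spins σ i := by
  cases h : σ i <;> simp [spins, h]

theorem magnetization_spins_update :
    magnetization n (spins (Function.update σ i (!σ i)))
      = magnetization n (spins σ) - 2 * spins σ i := by
  unfold magnetization
  rw [← Finset.add_sum_erase _ _ (Finset.mem_univ i), spins_update_self,
    ← Finset.add_sum_erase _ (spins σ) (Finset.mem_univ i)]
  have : ∑ j ∈ Finset.univ.erase i, spins (Function.update σ i (!σ i)) j
      = ∑ j ∈ Finset.univ.erase i, spins σ j :=
    Finset.sum_congr rfl fun j hj => by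
      simp [spins, Function.update_of_ne (Finset.ne_of_mem_erase hj)]
  rw [this]; ring

theorem abs_magnetization_spins_le : |magnetization n (spins σ)| ≤ n := by
  refine (Finset.abs_sum_le_sum_abs _ _).trans ?_
  have : ∀ j ∈ (Finset.univ : Finset (Fin n)), |spins σ j| ≤ 1 := fun j _ => by
    rcases spins_eq σ j with h | h <;> simp [h]
  simpa using Finset.sum_le_sum this

end flip

/-- The two spin values contribute opposite amounts to the one-site Gibbs integration by parts. -/
theorem one_site_cancel (f : ℝ → ℝ) (β δ r : ℝ) {x : ℝ} (hx : x = 1 ∨ x = -1) :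
    Real.exp (β * δ ^ 2 / 2 * (r + x) ^ 2)
        * ((x - Real.tanh (β * δ ^ 2 * r)) * f (δ * (r + x))
          - (1 - Real.tanh (β * δ ^ 2 * r) ^ 2) * ((f (δ * r + δ) - f (δ * r - δ)) / 2))
      + Real.exp (β * δ ^ 2 / 2 * (r + -x) ^ 2)
        * ((-x - Real.tanh (β * δ ^ 2 * r)) * f (δ * (r + -x))
          - (1 - Real.tanh (β * δ ^ 2 * r) ^ 2) * ((f (δ * r + δ) - f (δ * r - δ)) / 2)) = 0 := by
  have hp : Real.exp (β * δ ^ 2 / 2 * (r + 1) ^ 2)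
      = Real.exp (β * δ ^ 2 / 2 * (r ^ 2 + 1)) * Real.exp (β * δ ^ 2 * r) := by
    rw [← Real.exp_add]; ring_nf
  have hm : Real.exp (β * δ ^ 2 / 2 * (r + -1) ^ 2)
      = Real.exp (β * δ ^ 2 / 2 * (r ^ 2 + 1)) * Real.exp (-(β * δ ^ 2 * r)) := by
    rw [← Real.exp_add]; ring_nf
  -- The ratio of the conditional probabilities of the two spin values is `exp (2 β δ² r)`.
  have ht : (1 - Real.tanh (β * δ ^ 2 * r)) * Real.exp (β * δ ^ 2 * r)
      = (1 + Real.tanh (β * δ ^ 2 * r)) * Real.exp (-(β * δ ^ 2 * r)) := by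
    have h1 := Real.exp_pos (β * δ ^ 2 * r)
    have h2 := Real.exp_pos (-(β * δ ^ 2 * r))
    rw [Real.tanh_eq_sinh_div_cosh, Real.sinh_eq, Real.cosh_eq]
    field_simp
    ring
  have e1 : δ * (r + 1) = δ * r + δ := by ring
  have e2 : δ * (r + -1) = δ * r - δ := by ring
  rcases hx with rfl | rfl
  · rw [hp, hm, e1, e2]
    generalize Real.tanh (β * δ ^ 2 * r) = t at *
    generalize Real.exp (β * δ ^ 2 * r) = p at *
    generalize Real.exp (-(β * δ ^ 2 * r)) = m at *
    generalize Real.exp (β * δ ^ 2 / 2 * (r ^ 2 + 1)) = q at *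
    generalize f (δ * r + δ) = u at *
    generalize f (δ * r - δ) = v at *
    linear_combination (q * ((1 - t) * u + (1 + t) * v) / 2) * ht
  · rw [neg_neg, hp, hm, e1, e2]
    generalize Real.tanh (β * δ ^ 2 * r) = t at *
    generalize Real.exp (β * δ ^ 2 * r) = p at *
    generalize Real.exp (-(β * δ ^ 2 * r)) = m at *
    generalize Real.exp (β * δ ^ 2 / 2 * (r ^ 2 + 1)) = q at *
    generalize f (δ * r + δ) = u at *
    generalize f (δ * r - δ) = v at *
    linear_combination (q * ((1 - t) * u + (1 + t) * v) / 2) * ht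

/-- The contribution of one site with field `V` to the Gibbs integration by parts of `f`, where
`W` is the rescaled magnetization. -/
noncomputable def siteTerm (β δ : ℝ) (f : ℝ → ℝ) (W V : ℝ) : ℝ :=
  Real.tanh (β * δ * V) * f W
    + (1 - Real.tanh (β * δ * V) ^ 2) * ((f (V + δ) - f (V - δ)) / 2)

section identity

variable {n : ℕ} {β δ : ℝ}

/-- Flipping spin `i` leaves `V` unchanged, so the sum cancels in pairs `{σ, flipped σ}` by
`one_site_cancel`. -/
theorem gibbsMean_spin_mul (hδ : n * δ ^ 2 = 1) (f : ℝ → ℝ) (i : Fin n) :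
    gibbsMean n β (fun σ => spins σ i * f (δ * magnetization n (spins σ)))
      = gibbsMean n β (fun σ => siteTerm β δ f (δ * magnetization n (spins σ))
          (δ * magnetization n (spins σ) - δ * spins σ i)) := by
  rw [← sub_eq_zero, gibbsMean, gibbsMean, ← Finset.sum_sub_distrib]
  have hw : ∀ σ : Fin n → Bool, gibbsWeight n β σ
      = Real.exp (β * δ ^ 2 / 2 * magnetization n (spins σ) ^ 2) := by
    intro σ
    have hn : (n : ℝ) ≠ 0 := by rintro h; simp [h] at hδ
    rw [gibbsWeight, show β * δ ^ 2 / 2 = β / (2 * n) by field_simp; linear_combination β * hδ]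
  refine Finset.sum_involution (fun σ _ => Function.update σ i (!σ i)) ?_ ?_ ?_ ?_
  · intro σ _
    have key := one_site_cancel f β δ (magnetization n (spins σ) - spins σ i) (spins_eq σ i)
    rw [magnetization_spins_update, spins_update_self, hw σ, hw (Function.update _ _ _),
      magnetization_spins_update]
    simp only [siteTerm]
    generalize magnetization n (spins σ) = S at *
    generalize spins σ i = x at *
    have e1 : S - x + x = S := by ring
    have e2 : S - x + -x = S - 2 * x := by ring
    have e3 : δ * (S - 2 * x) - δ * -x = δ * (S - x) := by ring
    have e4 : δ * S - δ * x = δ * (S - x) := by ring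
    have e5 : β * δ * (δ * (S - x)) = β * δ ^ 2 * (S - x) := by ring
    rw [e1, e2] at key
    rw [e3, e4, e5]
    linear_combination (∑ τ, gibbsWeight n β τ)⁻¹ * key
  · intro σ _ _ h
    have := congrFun h i
    simp at this
  · exact fun _ _ => Finset.mem_univ _
  · intro σ _
    simp

/-- A lower bound on every site term bounds the Gibbs mean of `W f(W)` from below. -/
theorem gibbsMean_le_of_le_siteTerm (hδ0 : 0 ≤ δ) (hδ : n * δ ^ 2 = 1) (f : ℝ → ℝ)
    {B : (Fin n → Bool) → ℝ}
    (hB : ∀ σ i, δ * B σ ≤ siteTerm β δ f (δ * magnetization n (spins σ))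
      (δ * magnetization n (spins σ) - δ * spins σ i)) :
    gibbsMean n β B ≤ gibbsMean n β
      (fun σ => δ * magnetization n (spins σ) * f (δ * magnetization n (spins σ))) := by
  have h1 : gibbsMean n β
      (fun σ => δ * magnetization n (spins σ) * f (δ * magnetization n (spins σ)))
      = δ * ∑ i, gibbsMean n β
        (fun σ => spins σ i * f (δ * magnetization n (spins σ))) := by
    rw [← gibbsMean_sum, ← gibbsMean_const_mul]
    congr 1
    ext σ
    rw [← Finset.sum_mul]
    simp only [magnetization]
    ring
  have h2 : gibbsMean n β B = δ * ∑ _i : Fin n, δ * gibbsMean n β B := by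
    simp only [Finset.sum_const, Finset.card_univ, Fintype.card_fin, nsmul_eq_mul]
    linear_combination -(gibbsMean n β B) * hδ
  rw [h1, h2]
  refine mul_le_mul_of_nonneg_left (Finset.sum_le_sum fun i _ => ?_) hδ0
  rw [gibbsMean_spin_mul hδ, ← gibbsMean_const_mul]
  exact gibbsMean_mono fun σ => hB σ i

/-- An upper bound on every site term bounds the Gibbs mean of `W f(W)` from above. -/
theorem le_gibbsMean_of_siteTerm_le (hδ0 : 0 ≤ δ) (hδ : n * δ ^ 2 = 1) (f : ℝ → ℝ)
    {B : (Fin n → Bool) → ℝ}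
    (hB : ∀ σ i, siteTerm β δ f (δ * magnetization n (spins σ))
      (δ * magnetization n (spins σ) - δ * spins σ i) ≤ δ * B σ) :
    gibbsMean n β (fun σ => δ * magnetization n (spins σ) * f (δ * magnetization n (spins σ)))
      ≤ gibbsMean n β B := by
  have := gibbsMean_le_of_le_siteTerm (β := β) hδ0 hδ (fun x => -1 * f x)
    (B := fun σ => -1 * B σ) fun σ i => by
      have := hB σ i
      simp only [siteTerm] at this ⊢
      linarith
  have e : ∀ σ : Fin n → Bool,
      δ * magnetization n (spins σ) * (-1 * f (δ * magnetization n (spins σ)))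
      = -1 * (δ * magnetization n (spins σ) * f (δ * magnetization n (spins σ))) :=
    fun σ => by ring
  simp only [e, gibbsMean_const_mul] at this
  linarith

/-- For `f(x) = x` each site term is at most `δ (β W² + 2)`, whence `(1 - β) E[W²] ≤ 2`. -/
theorem gibbsMean_sq_le (hβ0 : 0 ≤ β) (hβ1 : β < 1) (hδ0 : 0 < δ) (hδ : n * δ ^ 2 = 1) :
    gibbsMean n β (fun σ => (δ * magnetization n (spins σ)) ^ 2) ≤ 2 / (1 - β) := by
  have h := le_gibbsMean_of_siteTerm_le (β := β) hδ0.le hδ (fun x => x)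
    (B := fun σ => β * (δ * magnetization n (spins σ)) ^ 2 + 2) fun σ i => by
      have hS := abs_magnetization_spins_le σ
      -- Since `|S_n| ≤ n`, this absorbs the correction `β δ² |W|` caused by replacing `V` with `W`.
      have hW : δ * |δ * magnetization n (spins σ)| ≤ 1 := by
        rw [abs_mul, abs_of_pos hδ0, ← hδ]
        nlinarith [sq_nonneg δ]
      have hx : |δ * spins σ i| ≤ δ := by
        rcases spins_eq σ i with h | h <;> simp [h, abs_of_pos hδ0]
      generalize δ * magnetization n (spins σ) = W at *
      generalize δ * spins σ i = y at *
      have ht := Real.abs_tanh_le_abs (β * δ * (W - y))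
      have hV : |W - y| ≤ |W| + δ := (abs_sub _ _).trans (by linarith)
      rw [abs_mul, abs_of_nonneg (by positivity : 0 ≤ β * δ)] at ht
      simp only [siteTerm]
      generalize Real.tanh (β * δ * (W - y)) = t at *
      have h1 : t * W ≤ β * δ * (|W| + δ) * |W| := by
        refine (le_abs_self _).trans ?_
        rw [abs_mul]
        gcongr
        exact ht.trans (by gcongr)
      have h2 : β * δ * (|W| + δ) * |W| ≤ β * δ * W ^ 2 + δ := by
        rw [← sq_abs W]
        have : β * δ * (δ * |W|) ≤ 1 * δ * 1 := by gcongr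
        nlinarith
      have h3 : 0 ≤ t ^ 2 * δ := by positivity
      linarith
  simp only [gibbsMean_add, gibbsMean_const_mul, gibbsMean_const, ← sq] at h
  rw [le_div_iff₀ (by linarith)]
  linarith

end identity

/-! ### Site terms of the Stein solution -/

namespace IsGaussianCDF

variable {a c M δ W y z : ℝ} {Φ : ℝ → ℝ}

theorem abs_mul_steinSolution_sub_le (h : IsGaussianCDF a c Φ) (hM : Real.exp (a / 2) + c / a ≤ M)
    (hy : |y - W| ≤ 2 * δ) :
    |y * steinSolution a Φ z y - W * steinSolution a Φ z W|
      ≤ δ * ((2 * M + 2 * c) * (1 + W ^ 2)) := by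
  have hc := h.c_pos
  have hδ : 0 ≤ δ := by linarith [abs_nonneg (y - W)]
  have h0 := h.steinSolution_nonneg z y
  have h1 := (h.steinSolution_le z y).trans hM
  have h2 := h.abs_steinSolution_sub_le z y W
  have hM0 : 0 ≤ M := h0.trans h1
  have e : y * steinSolution a Φ z y - W * steinSolution a Φ z W
      = (y - W) * steinSolution a Φ z y
        + W * (steinSolution a Φ z y - steinSolution a Φ z W) := by ring
  rw [e]
  calc _ ≤ |y - W| * steinSolution a Φ z y
        + |W| * |steinSolution a Φ z y - steinSolution a Φ z W| := by
        refine (abs_add_le _ _).trans_eq ?_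
        rw [abs_mul, abs_mul, abs_of_nonneg h0]
    _ ≤ 2 * δ * M + |W| * (2 * c * (2 * δ)) := by
        gcongr
        exact h2.trans (by gcongr)
    _ ≤ δ * ((2 * M + 2 * c) * (1 + W ^ 2)) := by
        have h3 : 2 * |W| ≤ 1 + W ^ 2 := by rw [← sq_abs W]; nlinarith [sq_nonneg (|W| - 1)]
        have h4 : 0 ≤ δ * M * W ^ 2 := by positivity
        nlinarith [mul_le_mul_of_nonneg_left h3 (mul_nonneg hδ hc.le)]

/-- Three errors, each of order `δ²`: linearising `tanh`, replacing `V` by `W`, and dropping `tanh²`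
in front of an increment that is itself `O(δ)`. -/
theorem abs_siteTerm_sub_le (h : IsGaussianCDF a c Φ) (hM : Real.exp (a / 2) + c / a ≤ M)
    (ha1 : a ≤ 1) (hδ0 : 0 ≤ δ) (hδ1 : δ ≤ 1) (hy : |y| ≤ δ) :
    |siteTerm (1 - a) δ (steinSolution a Φ z) W (W - y)
        - ((1 - a) * δ * (W * steinSolution a Φ z W)
          + (steinSolution a Φ z (W - y + δ) - steinSolution a Φ z (W - y - δ)) / 2)|
      ≤ δ ^ 2 * ((3 * M + 4 * c) * (1 + W ^ 2)) := by
  have ha := h.a_pos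
  have hc := h.c_pos
  have h0 := h.steinSolution_nonneg z W
  have h1 := (h.steinSolution_le z W).trans hM
  have hM0 : 0 ≤ M := h0.trans h1
  have hD := h.abs_steinSolution_sub_le z (W - y + δ) (W - y - δ)
  rw [show W - y + δ - (W - y - δ) = 2 * δ by ring, abs_of_nonneg (by linarith : 0 ≤ 2 * δ)] at hD
  have ht1 := Real.abs_tanh_le_abs ((1 - a) * δ * (W - y))
  have ht2 := Real.abs_tanh_sub_self_le ((1 - a) * δ * (W - y))
  have hV : (W - y) ^ 2 ≤ 2 * W ^ 2 + 2 := by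
    have : y ^ 2 ≤ 1 := (sq_le_one_iff_abs_le_one y).2 (hy.trans hδ1)
    nlinarith [sq_nonneg (W + y)]
  have hsq : ((1 - a) * δ * (W - y)) ^ 2 ≤ δ ^ 2 * (2 * W ^ 2 + 2) := by
    rw [mul_pow, mul_pow]
    have : (1 - a) ^ 2 ≤ 1 := by nlinarith
    have : (1 - a) ^ 2 * δ ^ 2 ≤ 1 * δ ^ 2 := by gcongr
    nlinarith [mul_le_mul this hV (sq_nonneg _) (by positivity)]
  unfold siteTerm
  have htsq : Real.tanh ((1 - a) * δ * (W - y)) ^ 2 ≤ δ ^ 2 * (2 * W ^ 2 + 2) :=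
    (sq_le_sq.2 ht1).trans hsq
  generalize Real.tanh ((1 - a) * δ * (W - y)) = t at *
  generalize steinSolution a Φ z (W - y + δ) - steinSolution a Φ z (W - y - δ) = D at *
  generalize steinSolution a Φ z W = F at *
  have h3 : |t - (1 - a) * δ * W| ≤ δ ^ 2 * (2 * W ^ 2 + 3) := by
    have e : t - (1 - a) * δ * W = (t - (1 - a) * δ * (W - y)) + -((1 - a) * δ * y) := by ring
    rw [e]
    refine (abs_add_le _ _).trans ?_
    have : |(1 - a) * δ * y| ≤ 1 * δ * δ := by
      rw [abs_mul, abs_mul, abs_of_nonneg hδ0, abs_of_nonneg (by linarith : 0 ≤ 1 - a)]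
      gcongr
      linarith
    rw [abs_neg]
    linarith
  have e : t * F + (1 - t ^ 2) * (D / 2) - ((1 - a) * δ * (W * F) + D / 2)
      = (t - (1 - a) * δ * W) * F + -(t ^ 2 * (D / 2)) := by ring
  rw [e]
  refine (abs_add_le _ _).trans ?_
  rw [abs_neg, abs_mul, abs_mul, abs_of_nonneg h0, abs_of_nonneg (sq_nonneg t)]
  have h4 : |D / 2| ≤ 2 * c := by
    rw [abs_div, abs_two]
    nlinarith
  calc _ ≤ δ ^ 2 * (2 * W ^ 2 + 3) * M + δ ^ 2 * (2 * W ^ 2 + 2) * (2 * c) := by gcongr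
    _ ≤ _ := by
        have : 0 ≤ δ ^ 2 * M * W ^ 2 := by positivity
        nlinarith

/-- The window `[V - δ, V + δ]` lies within `2δ` of `W`, so the Stein equation bounds `f'` there by
its value at `W` with a shifted indicator. The parts `a W f(W)` and `(1 - a) W f(W)` add up to `W
f(W)`, and `5M + 6c` is `3M + 4c` from `abs_siteTerm_sub_le` plus `2M + 2c` from
`abs_mul_steinSolution_sub_le`. -/
theorem le_siteTerm (h : IsGaussianCDF a c Φ) (hM : Real.exp (a / 2) + c / a ≤ M)
    (ha1 : a ≤ 1) (hδ0 : 0 ≤ δ) (hδ1 : δ ≤ 1) (hy : |y| ≤ δ) :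
    δ * (W * steinSolution a Φ z W + c * ((if W + 2 * δ < z then 1 else 0) - Φ z)
        - δ * ((5 * M + 6 * c) * (1 + W ^ 2)))
      ≤ siteTerm (1 - a) δ (steinSolution a Φ z) W (W - y) := by
  have ha := h.a_pos
  have hc := h.c_pos
  have hM0 : 0 ≤ M := (h.steinSolution_nonneg z W).trans ((h.steinSolution_le z W).trans hM)
  have h1 := (abs_le.1 (h.abs_siteTerm_sub_le (W := W) (z := z) hM ha1 hδ0 hδ1 hy)).1
  have hE : 0 ≤ δ * ((2 * M + 2 * c) * (1 + W ^ 2)) := by positivity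
  have h2 := h.le_steinSolution_sub z (u := W - y - δ) (v := W - y + δ)
    (A := a * (W * steinSolution a Φ z W) - δ * ((2 * M + 2 * c) * (1 + W ^ 2))
      + c * ((if W + 2 * δ < z then 1 else 0) - Φ z)) (by linarith) (fun x hx => by
      have hx1 : |x - W| ≤ 2 * δ := by
        have := abs_le.1 hy
        rw [abs_le]
        constructor <;> linarith [hx.1, hx.2]
      have h3 := (abs_le.1 (h.abs_mul_steinSolution_sub_le (z := z) hM hx1)).1
      have h4 : (if W + 2 * δ < z then (1 : ℝ) else 0) ≤ if x < z then 1 else 0 := by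
        have := (abs_le.1 hx1).2
        split_ifs <;> linarith
      unfold steinSolutionDeriv
      have h5 := mul_le_mul_of_nonneg_left h4 hc.le
      nlinarith)
  nlinarith

theorem siteTerm_le (h : IsGaussianCDF a c Φ) (hM : Real.exp (a / 2) + c / a ≤ M)
    (ha1 : a ≤ 1) (hδ0 : 0 ≤ δ) (hδ1 : δ ≤ 1) (hy : |y| ≤ δ) :
    siteTerm (1 - a) δ (steinSolution a Φ z) W (W - y)
      ≤ δ * (W * steinSolution a Φ z W + c * ((if W - 2 * δ < z then 1 else 0) - Φ z)
        + δ * ((5 * M + 6 * c) * (1 + W ^ 2))) := by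
  have ha := h.a_pos
  have hc := h.c_pos
  have hM0 : 0 ≤ M := (h.steinSolution_nonneg z W).trans ((h.steinSolution_le z W).trans hM)
  have h1 := (abs_le.1 (h.abs_siteTerm_sub_le (W := W) (z := z) hM ha1 hδ0 hδ1 hy)).2
  have hE : 0 ≤ δ * ((2 * M + 2 * c) * (1 + W ^ 2)) := by positivity
  have h2 := h.steinSolution_sub_le z (u := W - y - δ) (v := W - y + δ)
    (A := a * (W * steinSolution a Φ z W) + δ * ((2 * M + 2 * c) * (1 + W ^ 2))
      + c * ((if W - 2 * δ < z then 1 else 0) - Φ z)) (by linarith) (fun x hx => by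
      have hx1 : |x - W| ≤ 2 * δ := by
        have := abs_le.1 hy
        rw [abs_le]
        constructor <;> linarith [hx.1, hx.2]
      have h3 := (abs_le.1 (h.abs_mul_steinSolution_sub_le (z := z) hM hx1)).2
      have h4 : (if x < z then (1 : ℝ) else 0) ≤ if W - 2 * δ < z then 1 else 0 := by
        have := (abs_le.1 hx1).1
        split_ifs <;> linarith
      unfold steinSolutionDeriv
      have h5 := mul_le_mul_of_nonneg_left h4 hc.le
      nlinarith)
  nlinarith

end IsGaussianCDF

/-! ### Comparison of distribution functions -/

section comparison

variable {n : ℕ} {a c M δ : ℝ} {Φ : ℝ → ℝ}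

theorem abs_mul_spins_le (hδ0 : 0 < δ) (σ : Fin n → Bool) (i : Fin n) : |δ * spins σ i| ≤ δ := by
  rcases spins_eq σ i with h | h <;> simp [h, abs_of_pos hδ0]

theorem gibbsMean_error_le (hK : 0 ≤ M) (ha : 0 < a) (ha1 : a ≤ 1) (hδ0 : 0 < δ)
    (hδ : n * δ ^ 2 = 1) :
    gibbsMean n (1 - a) (fun σ => δ * (M * (1 + (δ * magnetization n (spins σ)) ^ 2)))
      ≤ δ * (M * (1 + 2 / a)) := by
  have h := gibbsMean_sq_le (sub_nonneg.2 ha1) (by linarith : 1 - a < 1) hδ0 hδ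
  rw [sub_sub_cancel] at h
  rw [gibbsMean_const_mul, gibbsMean_const_mul, gibbsMean_add, gibbsMean_const]
  gcongr

/-- `E[W f(W)]` occurs on both sides of the integrated site bound and cancels, leaving only the
indicator and the error. -/
theorem gibbsMean_lt_le (h : IsGaussianCDF a c Φ) (hM : Real.exp (a / 2) + c / a ≤ M)
    (ha1 : a ≤ 1) (hδ0 : 0 < δ) (hδ1 : δ ≤ 1) (hδ : n * δ ^ 2 = 1) (z : ℝ) :
    c * (gibbsMean n (1 - a)
      (fun σ => if δ * magnetization n (spins σ) + 2 * δ < z then 1 else 0) - Φ z)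
      ≤ δ * ((5 * M + 6 * c) * (1 + 2 / a)) := by
  have hM0 : 0 ≤ M := (h.steinSolution_nonneg z 0).trans ((h.steinSolution_le z 0).trans hM)
  have hc := h.c_pos
  have h1 := gibbsMean_le_of_le_siteTerm hδ0.le hδ (steinSolution a Φ z) fun σ i =>
    h.le_siteTerm (z := z) hM ha1 hδ0.le hδ1 (abs_mul_spins_le hδ0 σ i)
  have h2 := gibbsMean_error_le (M := 5 * M + 6 * c) (by positivity) h.a_pos ha1 hδ0 hδ
  simp only [sub_eq_add_neg _ (_ * ((5 * M + 6 * c) * _)), sub_eq_add_neg _ (Φ z), gibbsMean_add,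
    gibbsMean_const_mul, gibbsMean_const, neg_eq_neg_one_mul (δ * _)] at h1 h2 ⊢
  linarith

theorem le_gibbsMean_lt (h : IsGaussianCDF a c Φ) (hM : Real.exp (a / 2) + c / a ≤ M)
    (ha1 : a ≤ 1) (hδ0 : 0 < δ) (hδ1 : δ ≤ 1) (hδ : n * δ ^ 2 = 1) (z : ℝ) :
    -(δ * ((5 * M + 6 * c) * (1 + 2 / a))) ≤ c * (gibbsMean n (1 - a)
      (fun σ => if δ * magnetization n (spins σ) - 2 * δ < z then 1 else 0) - Φ z) := by
  have hM0 : 0 ≤ M := (h.steinSolution_nonneg z 0).trans ((h.steinSolution_le z 0).trans hM)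
  have hc := h.c_pos
  have h1 := le_gibbsMean_of_siteTerm_le hδ0.le hδ (steinSolution a Φ z) fun σ i =>
    h.siteTerm_le (z := z) hM ha1 hδ0.le hδ1 (abs_mul_spins_le hδ0 σ i)
  have h2 := gibbsMean_error_le (M := 5 * M + 6 * c) (by positivity) h.a_pos ha1 hδ0 hδ
  simp only [sub_eq_add_neg _ (Φ z), gibbsMean_add, gibbsMean_const_mul, gibbsMean_const]
    at h1 h2 ⊢
  linarith

theorem abs_gibbsMean_le_sub_le (h : IsGaussianCDF a c Φ) (hM : Real.exp (a / 2) + c / a ≤ M)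
    (ha1 : a ≤ 1) (hδ0 : 0 < δ) (hδ1 : δ ≤ 1) (hδ : n * δ ^ 2 = 1) (z : ℝ) :
    |gibbsMean n (1 - a) (fun σ => if δ * magnetization n (spins σ) ≤ z then 1 else 0) - Φ z|
      ≤ ((5 * M + 6 * c) * (1 + 2 / a) / c + 3 * c) * δ := by
  have hc := h.c_pos
  have h1 := h.sub_le (x := z) (y := z + 3 * δ) (by linarith)
  have h2 := h.sub_le (x := z - 2 * δ) (y := z) (by linarith)
  -- Shifting by `3δ` rather than `2δ` makes `W ≤ z` imply the strict inequality; below `z`, a shift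
  -- of `2δ` suffices.
  have h3 := gibbsMean_lt_le h hM ha1 hδ0 hδ1 hδ (z + 3 * δ)
  have h4 := le_gibbsMean_lt h hM ha1 hδ0 hδ1 hδ (z - 2 * δ)
  have h5 : gibbsMean n (1 - a)
        (fun σ => if δ * magnetization n (spins σ) ≤ z then 1 else 0)
      ≤ gibbsMean n (1 - a)
        (fun σ => if δ * magnetization n (spins σ) + 2 * δ < z + 3 * δ then 1 else 0) :=
    gibbsMean_mono fun σ => by split_ifs <;> linarith
  have h6 : gibbsMean n (1 - a)
        (fun σ => if δ * magnetization n (spins σ) - 2 * δ < z - 2 * δ then 1 else 0)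
      ≤ gibbsMean n (1 - a)
        (fun σ => if δ * magnetization n (spins σ) ≤ z then 1 else 0) :=
    gibbsMean_mono fun σ => by split_ifs <;> linarith
  have e : (5 * M + 6 * c) * (1 + 2 / a) / c * δ
      = δ * ((5 * M + 6 * c) * (1 + 2 / a)) / c := by ring
  rw [← le_div_iff₀' hc] at h3
  rw [← div_le_iff₀' hc, neg_div] at h4
  rw [add_mul, e, abs_le]
  have := mul_pos hc hδ0
  constructor <;> linarith

end comparison

theorem theorem1p1 (β : ℝ) (hβ0 : 0 < β) (hβ1 : β < 1) :
    ∃ C : ℝ, ∀ n : ℕ, 1 ≤ n →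
      (⨆ z : ℝ,
        |(curieWeiss classicalSpin n β).real {x | magnetization n x / √(n : ℝ) ≤ z}
          - cdf (gaussianReal 0 (1 - β)⁻¹.toNNReal) z|)
        ≤ C * (n : ℝ) ^ (-(1 / 2) : ℝ) := by
  obtain ⟨c, h⟩ := isGaussianCDF_cdf_gaussianReal (sub_pos.2 hβ1)
  -- The constant of `abs_gibbsMean_le_sub_le` at `a = 1 - β`, with `M` as small as allowed.
  refine ⟨(5 * (Real.exp ((1 - β) / 2) + c / (1 - β)) + 6 * c) * (1 + 2 / (1 - β)) / c + 3 * c,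
    fun n hn => ciSup_le fun z => ?_⟩
  have hn1 : (1 : ℝ) ≤ n := by exact_mod_cast hn
  have hn0 : (0 : ℝ) < n := by linarith
  have hδ : (n : ℝ) ^ (-(1 / 2) : ℝ) = (√(n : ℝ))⁻¹ := by
    rw [Real.rpow_neg hn0.le, Real.sqrt_eq_rpow]
  have key := abs_gibbsMean_le_sub_le h le_rfl (by linarith) (inv_pos.2 (Real.sqrt_pos.2 hn0))
    (inv_le_one_of_one_le₀ (Real.one_le_sqrt.2 hn1))
    (by rw [inv_pow, Real.sq_sqrt hn0.le, mul_inv_cancel₀ hn0.ne']) z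
  have hmeas : MeasurableSet {x : Fin n → ℝ | magnetization n x / √(n : ℝ) ≤ z} :=
    measurableSet_le (by unfold magnetization; fun_prop) measurable_const
  rw [hδ, curieWeiss_real_eq_gibbsMean n β hmeas]
  rw [sub_sub_cancel] at key
  have hind : ∀ σ : Fin n → Bool,
      {x | magnetization n x / √(n : ℝ) ≤ z}.indicator (fun _ => (1 : ℝ)) (spins σ)
        = if (√(n : ℝ))⁻¹ * magnetization n (spins σ) ≤ z then 1 else 0 := fun σ => by
    simp only [indicator, mem_ofPred_eq, div_eq_inv_mul]
  simpa only [hind] using key
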